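/- **Theorem.** Let $C\subseteq\mathbb{R}^d$ be a proper polyhedral cone, i.e. $C=\{a\in\mathbb{R}^d\mid \ell_1(a)\ge 0,\ldots,\ell_m(a)\ge 0\}$ for some linear functionals $\ell_1,\ldots,\ell_m:\mathbb{R}^d\to\mathbb{R}$, and $C$ is closed, has nonempty interior and satisfies $C\cap(-C)=\{0\}$. Then $C$ is also finitely generated, i.e. $C=\{\sum_{i=1}^n\lambda_i v_i\mid \lambda_1,\ldots,\lambda_n\ge 0\}$ for some $v_1,\ldots,v_n\in\mathbb{R}^d$. For any such descriptions of $C$, by functionals $\ell_1,\ldots,\ell_m$ and by generators $v_1,\ldots,v_n$, and for $s\in\mathbb{N}$, let $\mathrm{Her}_s$ be the space of complex Hermitian $s\times s$ matrices, let $\geqslant 0$ mean positive semidefinite, and put $$C_s^{\rm ph}:=\{(A_1,\ldots,A_d)\in\mathrm{Her}_s^d\mid \ell_i(A_1,\ldots,A_d)\geqslant 0,\ i=1,\ldots,m\},$$ $$C_s^{\rm pt}:=\Big\{\sum_{i=1}^n P_i\otimes v_i\ \Big|\ P_i\in\mathrm{Her}_s,\ P_i\geqslant 0,\ i=1,\ldots,n\Big\},$$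 where $\ell(A_1,\ldots,A_d)=\sum_j \ell(e_j)A_j$ and $P\otimes v=(v_1P,\ldots,v_dP)$ for $v=(v_1,\ldots,v_d)\in\mathbb{R}^d$; further $C^{\rm ph}:=(C_s^{\rm ph})_{s\in\mathbb{N}}$ and $C^{\rm pt}:=(C_s^{\rm pt})_{s\in\mathbb{N}}$. Call $C$ a simplex cone if it is generated by linearly independent vectors. Then: (i) If $C$ is a simplex cone, then $C^{\rm pt}=C^{\rm ph}$. (ii) If $C$ is not a simplex cone, then $C_2^{\rm pt}\subsetneq C_2^{\rm ph}$. -/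

import Mathlib

open scoped ComplexOrder

/-- The cone `{a ∈ ℝ^d | ℓ₁(a) ≥ 0, …, ℓₘ(a) ≥ 0}` cut out by finitely many linear functionals. -/
def polyhedralSet {d m : ℕ} (ℓ : Fin m → Module.Dual ℝ (Fin d → ℝ)) : Set (Fin d → ℝ) :=
  {a | ∀ i, 0 ≤ ℓ i a}

/-- The conical hull `cc{v₁, …, vₙ}` of finitely many vectors in `ℝ^d`. -/
def conicalHull {d n : ℕ} (v : Fin n → (Fin d → ℝ)) : Set (Fin d → ℝ) :=
  {a | ∃ c : Fin n → ℝ, (∀ i, 0 ≤ c i) ∧ a = ∑ i, c i • v i}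

/-- A convex cone in `ℝ^d` is polyhedral if it is cut out by finitely many linear functionals. -/
def IsPolyhedralCone {d : ℕ} (C : PointedCone ℝ (Fin d → ℝ)) : Prop :=
  ∃ (m : ℕ) (ℓ : Fin m → Module.Dual ℝ (Fin d → ℝ)), (C : Set (Fin d → ℝ)) = polyhedralSet ℓ

/-- A convex cone in `ℝ^d` is polytopal if it is the conical hull of finitely many vectors. -/
def IsPolytopalCone {d : ℕ} (C : PointedCone ℝ (Fin d → ℝ)) : Prop :=
  ∃ (n : ℕ) (v : Fin n → (Fin d → ℝ)), (C : Set (Fin d → ℝ)) = conicalHull v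

/-- A convex cone in `ℝ^d` is proper if it is closed, has nonempty interior, and satisfies
`C ∩ -C = {0}`. -/
structure IsProperConvexCone {d : ℕ} (C : PointedCone ℝ (Fin d → ℝ)) : Prop where
  isClosed : IsClosed (C : Set (Fin d → ℝ))
  nonempty_interior : (interior (C : Set (Fin d → ℝ))).Nonempty
  inter_neg : {a | a ∈ C ∧ -a ∈ C} = ({0} : Set (Fin d → ℝ))

/-- `d`-tuples of complex `s × s` matrices. -/
abbrev MatrixTuple (d s : ℕ) : Type := Fin d → Matrix (Fin s) (Fin s) ℂ

/-- The value `ℓ(A₁, …, A_d) = ∑ j, ℓ(e_j) A_j` of a real linear functional at a matrix tuple. -/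
noncomputable def evalAtTuple {d s : ℕ} (ℓ : Module.Dual ℝ (Fin d → ℝ)) (A : MatrixTuple d s) :
    Matrix (Fin s) (Fin s) ℂ :=
  ∑ j, ℓ (Pi.single j 1) • A j

/-- The tuple `P ⊗ v = (v₁ P, …, v_d P)`. -/
noncomputable def tensorTuple {d s : ℕ} (P : Matrix (Fin s) (Fin s) ℂ) (v : Fin d → ℝ) :
    MatrixTuple d s :=
  fun j => v j • P

/-- The non-commutative polyhedral extension given by functionals `ℓ`: its level `s` is the set of
tuples of Hermitian `s × s` matrices at which every `ℓᵢ` is positive semidefinite. -/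
def polyhedralExtension {d m : ℕ} (ℓ : Fin m → Module.Dual ℝ (Fin d → ℝ)) :
    (s : ℕ) → Set (MatrixTuple d s) :=
  fun _ => {A | (∀ j, (A j).IsHermitian) ∧ ∀ i, (evalAtTuple (ℓ i) A).PosSemidef}

/-- The non-commutative polytopal extension given by generators `v`: its level `s` is the set of
tuples `∑ i, Pᵢ ⊗ vᵢ` with `Pᵢ` positive semidefinite (in particular Hermitian) of size `s`. -/
def polytopalExtension {d n : ℕ} (v : Fin n → (Fin d → ℝ)) :
    (s : ℕ) → Set (MatrixTuple d s) :=
  fun s => {A | ∃ P : Fin n → Matrix (Fin s) (Fin s) ℂ,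
    (∀ i, (P i).PosSemidef) ∧ A = ∑ i, tensorTuple (P i) (v i)}

/-!
# Noncommutative polyhedral and polytopal extensions of a cone

*Finite generation.* Let `C = {ℓᵢ ≥ 0}` contain no line. For every set `T` of indices choose a
nonzero point `p_T` of the face `C ∩ {ℓᵢ = 0, i ∈ T}`, if there is one. From `a ∈ C` with set `T` of
tight constraints the largest possible multiple of `p_T` can be subtracted, which makes a further
constraint tight; after finitely many steps nothing is left. So the `p_T` generate `C`
(`exists_polyhedralSet_eq_conicalHull`).

*Compressions.* A Hermitian tuple `A` lies in the polyhedral extension if and only if all real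
vectors `x* A x = (x* A₁ x, …, x* A_d x)` lie in `C` (`mem_polyhedralExtension_iff`). Hence
`Cᵖᵗ ⊆ Cᵖʰ`. If `C` is generated by a basis, then the coordinate functionals of this basis
are nonnegative on `C`, therefore positive semidefinite at `A`, and they are the coefficients of `A`
in a polytopal representation (`polyhedralExtension_subset_of_basis`).

*Cones that are not simplex cones.* For `x₁, x₂ ∈ C` and a vector `y` at which every `ℓᵢ` tight at
`x₁` or at `x₂` vanishes, the tuple `[[x₁, εy], [εy, x₂]]` lies in `C₂ᵖʰ` for small `ε > 0`. If it lies
in `C₂ᵖᵗ`, then `y` is a combination of generators with a nonzero off-diagonal coefficient; these have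
both diagonal coefficients positive, so they lie in the smallest faces of `C` around `x₁` and `x₂`
(`mem_span_of_symmetricPencil_mem`). Consequently, if `C₂ᵖᵗ = C₂ᵖʰ`, then any two faces `F₁`, `F₂`
satisfy `span F₁ ∩ span F₂ = span (F₁ ∩ F₂)` (`FaceSpans.union`). Applied to facets, which span their
hyperplanes, this shows that for facet functionals forming a basis of the dual space all intersections
of the hyperplanes are spanned by faces. In particular the dual basis consists of vectors of
`C`, and so it generates `C` (`isSimplicial_of_polyhedralExtension_subset`).
-/

open Matrix

lemma exists_pos_forall_mul_le {ι : Type*} [Finite ι] (α β : ι → ℝ) :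
    ∃ ε > 0, ∀ i, 0 < α i → ε * β i ≤ α i := by
  have h : ∀ᶠ ε : ℝ in nhdsWithin 0 (Set.Ioi 0), ∀ i, 0 < α i → ε * β i ≤ α i := by
    refine Filter.eventually_all.2 fun i => ?_
    by_cases hi : 0 < α i
    · have ht : Filter.Tendsto (fun ε : ℝ => ε * β i) (nhds 0) (nhds (0 * β i)) :=
        Filter.tendsto_id.mul_const _
      rw [zero_mul] at ht
      filter_upwards [(ht.mono_left nhdsWithin_le_nhds).eventually (gt_mem_nhds hi)] with ε hε _
      exact hε.le
    · exact Filter.Eventually.of_forall fun _ h => absurd h hi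
  obtain ⟨ε, h1, h2⟩ := (h.and self_mem_nhdsWithin).exists
  exact ⟨ε, h2, h1⟩

/-! ### Finite generation of polyhedral cones -/

section Generators

variable {d m : ℕ} (ℓ : Fin m → Module.Dual ℝ (Fin d → ℝ))

/-- The Minkowski–Weyl theorem for a polyhedral cone that contains no line. -/
theorem exists_polyhedralSet_eq_conicalHull
    (hs : ∀ a, a ∈ polyhedralSet ℓ → -a ∈ polyhedralSet ℓ → a = 0) :
    ∃ (n : ℕ) (v : Fin n → (Fin d → ℝ)), polyhedralSet ℓ = conicalHull v := by
  classical
  -- A point `p T` of the face cut out by `T`, zero only if this face is zero.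
  have hp : ∀ T : Finset (Fin m), ∃ p ∈ polyhedralSet ℓ, (∀ i ∈ T, ℓ i p = 0) ∧
      ∀ a ∈ polyhedralSet ℓ, (∀ i ∈ T, ℓ i a = 0) → a ≠ 0 → p ≠ 0 := by
    intro T
    by_cases h : ∃ p ∈ polyhedralSet ℓ, (∀ i ∈ T, ℓ i p = 0) ∧ p ≠ 0
    · obtain ⟨p, h1, h2, h3⟩ := h
      exact ⟨p, h1, h2, fun _ _ _ _ => h3⟩
    · exact ⟨0, fun i => by simp, fun i _ => by simp, fun a h1 h2 h3 => absurd ⟨a, h1, h2, h3⟩ h⟩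
  choose p hpK hpT hp0 using hp
  -- Induction on the number of constraints that are not tight at `a`.
  have key : ∀ N : ℕ, ∀ a ∈ polyhedralSet ℓ, (Finset.univ.filter fun i => ℓ i a ≠ 0).card ≤ N →
      ∃ c : Finset (Fin m) → ℝ, (∀ T, 0 ≤ c T) ∧ a = ∑ T, c T • p T := by
    intro N
    induction N with
    | zero =>
      intro a ha hN
      have h0 : ∀ i, ℓ i a = 0 := by
        simpa [Finset.filter_eq_empty_iff] using hN
      exact ⟨0, fun _ => le_rfl, by simpa using hs a ha fun i => by simp [h0]⟩
    | succ N ih =>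
      intro a ha hN
      by_cases ha0 : a = 0
      · exact ⟨0, fun _ => le_rfl, by simp [ha0]⟩
      set T := Finset.univ.filter fun i => ℓ i a = 0 with hT
      have hq0 : p T ≠ 0 := hp0 T a ha (by simp [hT]) ha0
      have hne : (Finset.univ.filter fun i => 0 < ℓ i (p T)).Nonempty := by
        by_contra hcon
        refine hq0 (hs _ (hpK T) fun i => ?_)
        have : ¬ 0 < ℓ i (p T) := fun h => hcon ⟨i, by simp [h]⟩
        rw [map_neg]
        linarith
      -- The constraint `i₀` is the first to become tight when moving from `a` along `-p T`.
      obtain ⟨i₀, hi₀, hmin⟩ := Finset.exists_min_image _ (fun i => ℓ i a / ℓ i (p T)) hne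
      have hi₀' : 0 < ℓ i₀ (p T) := by simpa using hi₀
      set s := ℓ i₀ a / ℓ i₀ (p T) with hs'
      have hs0 : 0 ≤ s := div_nonneg (ha i₀) hi₀'.le
      have ha' : a - s • p T ∈ polyhedralSet ℓ := by
        intro i
        rw [map_sub, map_smul, smul_eq_mul]
        rcases (hpK T i).eq_or_lt with h | h
        · rw [← h]
          simpa using ha i
        · have := (le_div_iff₀ h).1 (hmin i (by simp [h]))
          linarith
      have hcard : (Finset.univ.filter fun i => ℓ i (a - s • p T) ≠ 0).card ≤ N := by
        refine Nat.le_of_lt_succ (lt_of_lt_of_le (Finset.card_lt_card ?_) hN)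
        refine Finset.ssubset_iff_of_subset (fun i hi => ?_) |>.2 ⟨i₀, ?_, ?_⟩
        · simp only [Finset.mem_filter, Finset.mem_univ, true_and] at hi ⊢
          intro h
          exact hi (by simp [h, hpT T i (by simp [hT, h])])
        · simp only [Finset.mem_filter, Finset.mem_univ, true_and]
          intro h
          exact hi₀'.ne' (hpT T i₀ (by simp [hT, h]))
        · simp [hs', hi₀'.ne']
      obtain ⟨c, hc, hac⟩ := ih _ ha' hcard
      refine ⟨c + Pi.single T s, fun T' => add_nonneg (hc T') ?_, ?_⟩
      · exact (Pi.single_nonneg.2 hs0 : (0 : Finset (Fin m) → ℝ) ≤ Pi.single T s) T'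
      · simp only [Pi.add_apply, add_smul, Finset.sum_add_distrib, ← hac]
        rw [Finset.sum_eq_single T (by intro b _ hb; simp [Pi.single_eq_of_ne hb]) (by simp)]
        simp
  let e := Fintype.equivFin (Finset (Fin m))
  refine ⟨_, fun j => p (e.symm j), Set.Subset.antisymm (fun a ha => ?_) ?_⟩
  · obtain ⟨c, hc, h⟩ := key _ a ha le_rfl
    exact ⟨fun j => c (e.symm j), fun j => hc _, by rw [h, ← e.symm.sum_comp]⟩
  · rintro _ ⟨c, hc, rfl⟩ i
    simp only [map_sum, map_smul, smul_eq_mul]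
    exact Finset.sum_nonneg fun j _ => mul_nonneg (hc j) (hpK _ i)

end Generators

lemma mem_conicalHull {d n : ℕ} (v : Fin n → (Fin d → ℝ)) (i : Fin n) : v i ∈ conicalHull v :=
  ⟨Pi.single i 1, (Pi.single_nonneg.2 zero_le_one : (0 : Fin n → ℝ) ≤ Pi.single i 1), by
    rw [Finset.sum_eq_single i (by intro b _ hb; simp [Pi.single_eq_of_ne hb]) (by simp)]
    simp⟩

/-! ### Compressions and the noncommutative extensions -/

section Extensions

variable {d s : ℕ}

/-- The real vector `(x* A₁ x, …, x* A_d x)`. The real parts taken in the definition lose nothing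
for the tuples of Hermitian matrices to which it is applied. -/
noncomputable def compression (A : MatrixTuple d s) (x : Fin s → ℂ) : Fin d → ℝ :=
  fun k => (star x ⬝ᵥ (A k *ᵥ x)).re

lemma dual_apply_eq_sum (ℓ : Module.Dual ℝ (Fin d → ℝ)) (a : Fin d → ℝ) :
    ℓ a = ∑ j, ℓ (Pi.single j 1) * a j := by
  conv_lhs => rw [pi_eq_sum_univ' a]
  simp [map_sum, mul_comm]

lemma apply_compression (ℓ : Module.Dual ℝ (Fin d → ℝ)) (A : MatrixTuple d s) (x : Fin s → ℂ) :
    ℓ (compression A x) = (star x ⬝ᵥ (evalAtTuple ℓ A *ᵥ x)).re := by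
  rw [dual_apply_eq_sum]
  simp only [evalAtTuple, Matrix.sum_mulVec, dotProduct_sum, Matrix.smul_mulVec, dotProduct_smul,
    Complex.re_sum, Complex.smul_re, smul_eq_mul, compression]

lemma isHermitian_real_smul {P : Matrix (Fin s) (Fin s) ℂ} (hP : P.IsHermitian) (c : ℝ) :
    (c • P).IsHermitian := by
  simp [Matrix.IsHermitian, Matrix.conjTranspose_smul, hP.eq]

lemma posSemidef_evalAtTuple_iff (ℓ : Module.Dual ℝ (Fin d → ℝ)) {A : MatrixTuple d s}
    (hA : ∀ j, (A j).IsHermitian) :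
    (evalAtTuple ℓ A).PosSemidef ↔ ∀ x, 0 ≤ ℓ (compression A x) := by
  have hH : (evalAtTuple ℓ A).IsHermitian := by
    rw [Matrix.IsHermitian, evalAtTuple, Matrix.conjTranspose_sum]
    exact Finset.sum_congr rfl fun j _ => isHermitian_real_smul (hA j) _
  refine ⟨fun h x => ?_, fun h => .of_dotProduct_mulVec_nonneg hH fun x => ?_⟩
  · rw [apply_compression]
    exact h.re_dotProduct_nonneg x
  · rw [Complex.nonneg_iff, ← apply_compression]
    exact ⟨h x, (hH.im_star_dotProduct_mulVec_self x).symm⟩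

/-- The polyhedral extension depends only on the cone: a Hermitian tuple belongs to it if and only if
all its compressions to vectors lie in the cone. -/
theorem mem_polyhedralExtension_iff {m : ℕ} (ℓ : Fin m → Module.Dual ℝ (Fin d → ℝ))
    (A : MatrixTuple d s) : A ∈ polyhedralExtension ℓ s ↔
      (∀ j, (A j).IsHermitian) ∧ ∀ x, compression A x ∈ polyhedralSet ℓ := by
  refine and_congr_right fun hA => ?_
  simp only [posSemidef_evalAtTuple_iff _ hA, polyhedralSet, Set.mem_ofPred_eq]
  exact forall_comm

lemma compression_sum_tensorTuple {n : ℕ} (P : Fin n → Matrix (Fin s) (Fin s) ℂ)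
    (v : Fin n → (Fin d → ℝ)) (x : Fin s → ℂ) :
    compression (∑ i, tensorTuple (P i) (v i)) x = ∑ i, (star x ⬝ᵥ (P i *ᵥ x)).re • v i := by
  ext k
  simp [compression, tensorTuple, Finset.sum_apply, Matrix.sum_mulVec, dotProduct_sum,
    Matrix.smul_mulVec, dotProduct_smul, Complex.re_sum, mul_comm]

theorem polytopalExtension_subset {m n : ℕ} {ℓ : Fin m → Module.Dual ℝ (Fin d → ℝ)}
    {v : Fin n → (Fin d → ℝ)} (h : conicalHull v ⊆ polyhedralSet ℓ) :
    polytopalExtension v s ⊆ polyhedralExtension ℓ s := by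
  rintro A ⟨P, hP, rfl⟩
  rw [mem_polyhedralExtension_iff]
  refine ⟨fun j => ?_, fun x => h ⟨_, fun i => (hP i).re_dotProduct_nonneg x,
    compression_sum_tensorTuple P v x⟩⟩
  rw [Finset.sum_apply, Matrix.IsHermitian, Matrix.conjTranspose_sum]
  exact Finset.sum_congr rfl fun i _ => isHermitian_real_smul (hP i).1 _

/-- If a basis lies in the cone and its coordinate functionals are nonnegative on the cone, then the
expansion of a tuple in this basis has positive semidefinite coefficients. -/
theorem polyhedralExtension_subset_of_basis {m n : ℕ} {ℓ : Fin m → Module.Dual ℝ (Fin d → ℝ)}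
    {v : Fin n → (Fin d → ℝ)} {ι : Type*} [Fintype ι] (b : Module.Basis ι ℝ (Fin d → ℝ))
    (hb : ∀ j, b j ∈ conicalHull v) (hℓ : ∀ a ∈ polyhedralSet ℓ, ∀ j, 0 ≤ b.coord j a) :
    polyhedralExtension ℓ s ⊆ polytopalExtension v s := by
  intro A hA
  rw [mem_polyhedralExtension_iff] at hA
  choose c hc hbc using hb
  have hpsd : ∀ j, (evalAtTuple (b.coord j) A).PosSemidef := fun j =>
    (posSemidef_evalAtTuple_iff _ hA.1).2 fun x => hℓ _ (hA.2 x) j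
  refine ⟨fun i => ∑ j, c j i • evalAtTuple (b.coord j) A, fun i =>
    Matrix.posSemidef_sum _ fun j _ => (hpsd j).smul (hc j i), ?_⟩
  -- The expansion `A = ∑ⱼ bⱼ*(A) ⊗ bⱼ` in the basis `b`.
  have hA' : ∀ k, A k = ∑ j, b j k • evalAtTuple (b.coord j) A := by
    intro k
    have h : ∀ l, ∑ j, b j k * b.coord j (Pi.single l 1) = if l = k then 1 else 0 := by
      intro l
      have := congrFun (b.sum_repr (Pi.single l (1 : ℝ))) k
      simp only [Finset.sum_apply, Pi.smul_apply, smul_eq_mul, Pi.single_apply] at this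
      simp only [Module.Basis.coord_apply, mul_comm (b _ k), this, eq_comm]
    simp only [evalAtTuple, Finset.smul_sum, smul_smul]
    rw [Finset.sum_comm]
    simp only [← Finset.sum_smul, h]
    simp
  funext k
  conv_lhs => rw [hA' k]
  simp only [Finset.sum_apply, tensorTuple, Finset.smul_sum, smul_smul]
  rw [Finset.sum_comm]
  refine Finset.sum_congr rfl fun j _ => ?_
  rw [← Finset.sum_smul]
  congr 1
  conv_lhs => rw [hbc j]
  simp [mul_comm]

/-! ### Tuples of `2 × 2` matrices with a given off-diagonal vector -/

/-- The tuple of real symmetric `2 × 2` matrices, written as the `2 × 2` matrix of vectors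
`[[x₁, y], [y, x₂]]`. -/
def symmetricPencil (x₁ x₂ y : Fin d → ℝ) : MatrixTuple d 2 :=
  fun k => !![(x₁ k : ℂ), (y k : ℂ); (y k : ℂ), (x₂ k : ℂ)]

lemma compression_symmetricPencil (x₁ x₂ y : Fin d → ℝ) (z : Fin 2 → ℂ) :
    compression (symmetricPencil x₁ x₂ y) z =
      ((z 0).re ^ 2 + (z 0).im ^ 2) • x₁ + (2 * ((z 0).re * (z 1).re + (z 0).im * (z 1).im)) • y +
        ((z 1).re ^ 2 + (z 1).im ^ 2) • x₂ := by
  ext k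
  simp [compression, symmetricPencil, Matrix.mulVec, dotProduct, Fin.sum_univ_two]
  ring

lemma binary_quadratic_nonneg {a b c : ℝ} (ha : 0 ≤ a) (hc : 0 ≤ c) (h : b ^ 2 ≤ a * c)
    (p r : ℝ) : 0 ≤ a * p ^ 2 + 2 * b * (p * r) + c * r ^ 2 := by
  rcases ha.eq_or_lt with rfl | ha
  · have : b = 0 := by nlinarith
    subst this
    nlinarith [mul_nonneg hc (sq_nonneg r)]
  · refine nonneg_of_mul_nonneg_right (b := a * p ^ 2 + 2 * b * (p * r) + c * r ^ 2) ?_ ha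
    nlinarith [sq_nonneg (a * p + b * r), mul_nonneg (sub_nonneg.2 h) (sq_nonneg r)]

theorem symmetricPencil_mem_polyhedralExtension {m : ℕ} {ℓ : Fin m → Module.Dual ℝ (Fin d → ℝ)}
    {x₁ x₂ y : Fin d → ℝ} (h₁ : x₁ ∈ polyhedralSet ℓ) (h₂ : x₂ ∈ polyhedralSet ℓ)
    (h : ∀ i, ℓ i y ^ 2 ≤ ℓ i x₁ * ℓ i x₂) :
    symmetricPencil x₁ x₂ y ∈ polyhedralExtension ℓ 2 := by
  rw [mem_polyhedralExtension_iff]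
  refine ⟨fun j => ?_, fun z i => ?_⟩
  · ext a b
    fin_cases a <;> fin_cases b <;> simp [symmetricPencil]
  · simp only [compression_symmetricPencil, map_add, map_smul, smul_eq_mul]
    have e₁ := binary_quadratic_nonneg (h₁ i) (h₂ i) (h i) (z 0).re (z 1).re
    have e₂ := binary_quadratic_nonneg (h₁ i) (h₂ i) (h i) (z 0).im (z 1).im
    linarith

lemma normSq_offDiag_le {P : Matrix (Fin 2) (Fin 2) ℂ} (hP : P.PosSemidef) :
    Complex.normSq (P 0 1) ≤ (P 0 0).re * (P 1 1).re := by
  have h := (Complex.nonneg_iff.1 hP.det_nonneg).1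
  have h0 := (Complex.nonneg_iff.1 (hP.diag_nonneg (i := 0))).2
  have h10 : P 1 0 = star (P 0 1) := (hP.1.apply 1 0).symm
  rw [Matrix.det_fin_two, h10] at h
  simp only [Complex.sub_re, Complex.mul_re, ← h0, Complex.star_def, Complex.conj_re,
    Complex.conj_im] at h
  rw [Complex.normSq_apply]
  linarith

/-- The off-diagonal vector of a tuple in the polytopal extension is spanned by the points of the cone
at which every constraint tight at one of the two diagonal vectors is tight. A generator contributes
to the off-diagonal entry only if it contributes to both diagonal entries. -/
theorem mem_span_of_symmetricPencil_mem {n m : ℕ} {v : Fin n → (Fin d → ℝ)}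
    {ℓ : Fin m → Module.Dual ℝ (Fin d → ℝ)} (hv : ∀ j, v j ∈ polyhedralSet ℓ)
    {x₁ x₂ y : Fin d → ℝ} (h : symmetricPencil x₁ x₂ y ∈ polytopalExtension v 2) :
    y ∈ Submodule.span ℝ {a | a ∈ polyhedralSet ℓ ∧
      ∀ i, (ℓ i x₁ = 0 ∨ ℓ i x₂ = 0) → ℓ i a = 0} := by
  obtain ⟨P, hP, h⟩ := h
  have entry : ∀ a b k, (symmetricPencil x₁ x₂ y k a b).re = ∑ j, (P j a b).re * v j k := by
    intro a b k
    rw [h]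
    simp [tensorTuple, Matrix.sum_apply, mul_comm]
  have hx₁ : x₁ = ∑ j, (P j 0 0).re • v j := by
    ext k; simpa [symmetricPencil] using entry 0 0 k
  have hx₂ : x₂ = ∑ j, (P j 1 1).re • v j := by
    ext k; simpa [symmetricPencil] using entry 1 1 k
  have hy : y = ∑ j, (P j 0 1).re • v j := by
    ext k; simpa [symmetricPencil] using entry 0 1 k
  have hdiag : ∀ j a, 0 ≤ (P j a a).re := fun j a =>
    (Complex.nonneg_iff.1 ((hP j).diag_nonneg (i := a))).1
  -- A constraint tight at a diagonal vector is tight at all generators contributing to it.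
  have vanish : ∀ (a : Fin 2) (i : Fin m), ℓ i (∑ j, (P j a a).re • v j) = 0 →
      ∀ j, (P j a a).re ≠ 0 → ℓ i (v j) = 0 := by
    intro a i h0 j hj
    simp only [map_sum, map_smul, smul_eq_mul] at h0
    rw [Finset.sum_eq_zero_iff_of_nonneg fun j _ => mul_nonneg (hdiag j a) (hv j i)] at h0
    exact (mul_eq_zero.1 (h0 j (Finset.mem_univ j))).resolve_left hj
  rw [hy]
  refine Submodule.sum_mem _ fun j _ => ?_
  by_cases hj : (P j 0 1).re = 0
  · simp [hj]
  refine Submodule.smul_mem _ _ (Submodule.subset_span ⟨hv j, fun i hi => ?_⟩)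
  have hpos : 0 < (P j 0 0).re * (P j 1 1).re := by
    refine lt_of_lt_of_le ?_ (normSq_offDiag_le (hP j))
    exact Complex.normSq_pos.2 fun h0 => hj (by simp [h0])
  rcases hi with hi | hi
  · exact vanish 0 i (hx₁ ▸ hi) j (left_ne_zero_of_mul hpos.ne')
  · exact vanish 1 i (hx₂ ▸ hi) j (right_ne_zero_of_mul hpos.ne')

end Extensions

/-! ### Faces that span the common kernel of their constraints -/

section Faces

variable {d m : ℕ} {ℓ : Fin m → Module.Dual ℝ (Fin d → ℝ)}

/-- The face of the cone `polyhedralSet ℓ` on which the constraints in `T` are tight spans the whole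
subspace `⋂ i ∈ T, ker ℓᵢ`. -/
def FaceSpans (ℓ : Fin m → Module.Dual ℝ (Fin d → ℝ)) (T : Set (Fin m)) : Prop :=
  ∀ y, (∀ i ∈ T, ℓ i y = 0) →
    y ∈ Submodule.span ℝ {a | a ∈ polyhedralSet ℓ ∧ ∀ i ∈ T, ℓ i a = 0}

/-- A spanning face has a point at which only those constraints are tight that vanish on the whole
subspace: a sum of points of the face, one for each constraint that does not vanish on the face. -/
lemma FaceSpans.exists_relInterior {T : Set (Fin m)} (hT : FaceSpans ℓ T) :
    ∃ x ∈ polyhedralSet ℓ, (∀ i ∈ T, ℓ i x = 0) ∧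
      ∀ i, ℓ i x = 0 → ∀ y, (∀ j ∈ T, ℓ j y = 0) → ℓ i y = 0 := by
  classical
  have hp : ∀ i, ∃ p ∈ polyhedralSet ℓ, (∀ j ∈ T, ℓ j p = 0) ∧
      (ℓ i p = 0 → ∀ a ∈ polyhedralSet ℓ, (∀ j ∈ T, ℓ j a = 0) → ℓ i a = 0) := by
    intro i
    by_cases h : ∃ p ∈ polyhedralSet ℓ, (∀ j ∈ T, ℓ j p = 0) ∧ ℓ i p ≠ 0
    · obtain ⟨p, h1, h2, h3⟩ := h
      exact ⟨p, h1, h2, fun h => absurd h h3⟩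
    · push Not at h
      exact ⟨0, fun i => by simp, by simp, fun _ => h⟩
  choose p hpK hpT hp0 using hp
  refine ⟨∑ k, p k, fun i => ?_, fun i hi => ?_, fun i hi y hy => ?_⟩
  · rw [map_sum]
    exact Finset.sum_nonneg fun k _ => hpK k i
  · rw [map_sum]
    exact Finset.sum_eq_zero fun k _ => hpT k i hi
  · rw [map_sum, Finset.sum_eq_zero_iff_of_nonneg fun k _ => hpK k i] at hi
    have hle : Submodule.span ℝ {a | a ∈ polyhedralSet ℓ ∧ ∀ j ∈ T, ℓ j a = 0} ≤
        LinearMap.ker (ℓ i) :=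
      Submodule.span_le.2 fun a ha => hp0 i (hi i (Finset.mem_univ i)) a ha.1 ha.2
    exact hle (hT y hy)

/-- If the polyhedral and the polytopal extension agree at level two, then the intersection of two
spanning faces is spanning. The witness is a tuple whose diagonal vectors are relative interior points
of the two faces and whose off-diagonal vector lies in the spans of both. -/
theorem FaceSpans.union {n : ℕ} {v : Fin n → (Fin d → ℝ)} (hv : ∀ j, v j ∈ polyhedralSet ℓ)
    (h : polyhedralExtension ℓ 2 ⊆ polytopalExtension v 2) {T₁ T₂ : Set (Fin m)}
    (hT₁ : FaceSpans ℓ T₁) (hT₂ : FaceSpans ℓ T₂) : FaceSpans ℓ (T₁ ∪ T₂) := by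
  intro y hy
  obtain ⟨x₁, hx₁, hx₁T, hx₁'⟩ := hT₁.exists_relInterior
  obtain ⟨x₂, hx₂, hx₂T, hx₂'⟩ := hT₂.exists_relInterior
  obtain ⟨ε, hε, hεle⟩ := exists_pos_forall_mul_le (fun i => ℓ i x₁ * ℓ i x₂)
    (fun i => ℓ i y ^ 2)
  have hmem : symmetricPencil x₁ x₂ (√ε • y) ∈ polyhedralExtension ℓ 2 := by
    refine symmetricPencil_mem_polyhedralExtension hx₁ hx₂ fun i => ?_
    rw [map_smul, smul_eq_mul, mul_pow, Real.sq_sqrt hε.le]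
    rcases (mul_nonneg (hx₁ i) (hx₂ i)).eq_or_lt with h0 | h0
    · have : ℓ i y = 0 := by
        rcases mul_eq_zero.1 h0.symm with h0 | h0
        · exact hx₁' i h0 y fun j hj => hy j (Or.inl hj)
        · exact hx₂' i h0 y fun j hj => hy j (Or.inr hj)
      simp [this, ← h0]
    · exact hεle i h0
  have hspan := mem_span_of_symmetricPencil_mem hv (h hmem)
  rw [Submodule.smul_mem_iff _ (Real.sqrt_pos.2 hε).ne'] at hspan
  refine Submodule.span_mono ?_ hspan
  rintro a ⟨ha, ha'⟩
  exact ⟨ha, fun i hi => ha' i (hi.imp (hx₁T i) (hx₂T i))⟩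

lemma FaceSpans.finset {n : ℕ} {v : Fin n → (Fin d → ℝ)} (hv : ∀ j, v j ∈ polyhedralSet ℓ)
    (h : polyhedralExtension ℓ 2 ⊆ polytopalExtension v 2)
    (htop : Submodule.span ℝ (polyhedralSet ℓ) = ⊤) (T : Finset (Fin m))
    (hT : ∀ i ∈ T, FaceSpans ℓ {i}) : FaceSpans ℓ (T : Set (Fin m)) := by
  classical
  induction T using Finset.induction_on with
  | empty => intro y _; simp [htop]
  | insert i T _ ih =>
    rw [Finset.coe_insert, Set.insert_eq]
    exact FaceSpans.union hv h (hT i (by simp)) (ih fun j hj => hT j (by simp [hj]))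

/-- An irredundant subfamily of the constraints defines the same cone, and its members define facets:
each of them vanishes on a face that spans its kernel. -/
theorem exists_facets (htop : Submodule.span ℝ (polyhedralSet ℓ) = ⊤) :
    ∃ S : Finset (Fin m), (∀ a, (∀ i ∈ S, 0 ≤ ℓ i a) → a ∈ polyhedralSet ℓ) ∧
      ∀ i ∈ S, FaceSpans ℓ {i} := by
  classical
  have hne : (Finset.univ.filter fun S : Finset (Fin m) =>
      ∀ a, (∀ i ∈ S, 0 ≤ ℓ i a) → a ∈ polyhedralSet ℓ).Nonempty :=
    ⟨Finset.univ, Finset.mem_filter.2 ⟨Finset.mem_univ _, fun _ ha i => ha i (Finset.mem_univ i)⟩⟩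
  obtain ⟨S, hS, hmin⟩ := Finset.exists_min_image _ Finset.card hne
  simp only [Finset.mem_filter, Finset.mem_univ, true_and] at hS hmin
  refine ⟨S, hS, fun i hi y hy => ?_⟩
  -- `c` is an interior point of the cone, and `z` violates only the constraint `i`.
  have hempty : FaceSpans ℓ ∅ := fun y _ => by simp [htop]
  obtain ⟨c, hc, -, hc'⟩ := hempty.exists_relInterior
  obtain ⟨z, hz, hzi⟩ : ∃ z, (∀ j ∈ S.erase i, 0 ≤ ℓ j z) ∧ ℓ i z < 0 := by
    by_contra! hcon
    refine absurd (hmin (S.erase i) fun a ha => hS a fun j hj => ?_)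
      (not_le.2 (Finset.card_erase_lt_of_mem hi))
    by_cases hji : j = i
    · exact hji ▸ hcon a ha
    · exact ha j (Finset.mem_erase.2 ⟨hji, hj⟩)
  have hci : 0 < ℓ i c := (hc i).lt_of_ne fun h0 => hzi.ne (hc' i h0.symm z (by simp))
  -- `p` lies in the relative interior of the facet: it is a positive multiple of the point where the
  -- segment from `c` to `z` crosses the hyperplane `ℓ i = 0`.
  set p := ℓ i c • z - ℓ i z • c with hp
  have hpi : ℓ i p = 0 := by simp [hp]; ring
  have hpj : ∀ j ∈ S.erase i, ℓ j p = 0 → ∀ w, ℓ j w = 0 := by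
    intro j hj h0 w
    refine hc' j ?_ w (by simp)
    have h1 := mul_nonneg hci.le (hz j hj)
    have h2 := mul_nonneg (neg_pos.2 hzi).le (hc j)
    simp only [hp, map_sub, map_smul, smul_eq_mul] at h0
    have h3 : -ℓ i z * ℓ j c = 0 := by linarith
    exact (mul_eq_zero.1 h3).resolve_left (neg_pos.2 hzi).ne'
  have hpK : ∀ j ∈ S.erase i, 0 ≤ ℓ j p := by
    intro j hj
    have h1 := mul_nonneg hci.le (hz j hj)
    have h2 := mul_nonneg (neg_pos.2 hzi).le (hc j)
    simp only [hp, map_sub, map_smul, smul_eq_mul]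
    linarith
  have hyi : ℓ i y = 0 := hy i rfl
  obtain ⟨ε, hε, hεle⟩ := exists_pos_forall_mul_le (fun j => ℓ j p) (fun j => -ℓ j y)
  have hmem : p + ε • y ∈ polyhedralSet ℓ := by
    refine hS _ fun j hj => ?_
    simp only [map_add, map_smul, smul_eq_mul]
    by_cases hji : j = i
    · simp [hji, hpi, hyi]
    have hj' := Finset.mem_erase.2 ⟨hji, hj⟩
    rcases (hpK j hj').eq_or_lt with h0 | h0
    · simp [hpj j hj' h0.symm]
    · linarith [hεle j h0]
  have hpmem : p ∈ polyhedralSet ℓ := by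
    refine hS _ fun j hj => ?_
    by_cases hji : j = i
    · exact hji ▸ hpi.ge
    · exact hpK j (Finset.mem_erase.2 ⟨hji, hj⟩)
  rw [← Submodule.smul_mem_iff _ hε.ne', ← add_sub_cancel_left p (ε • y)]
  refine Submodule.sub_mem _ (Submodule.subset_span ⟨hmem, ?_⟩) (Submodule.subset_span ⟨hpmem, ?_⟩)
  · simp [hpi, hyi]
  · simp [hpi]

/-- If the polyhedral and the polytopal extension agree at level two, then the cone is generated by
the basis dual to any basis of the dual space consisting of facet functionals. -/
theorem isSimplicial_of_polyhedralExtension_subset {n : ℕ} {v : Fin n → (Fin d → ℝ)}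
    {C : PointedCone ℝ (Fin d → ℝ)} (hC : (C : Set (Fin d → ℝ)) = polyhedralSet ℓ)
    (hv : ∀ j, v j ∈ polyhedralSet ℓ)
    (htop : Submodule.span ℝ (polyhedralSet ℓ) = ⊤)
    (hs : ∀ a, a ∈ polyhedralSet ℓ → -a ∈ polyhedralSet ℓ → a = 0)
    (h : polyhedralExtension ℓ 2 ⊆ polytopalExtension v 2) : C.IsSimplicial := by
  classical
  obtain ⟨S, hS, hface⟩ := exists_facets htop
  -- The facet functionals span the dual space because the cone contains no line.
  have hspan : ⊤ ≤ Submodule.span ℝ (ℓ '' S) := by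
    rw [← Subspace.dualCoannihilator_dualAnnihilator_eq (W := Submodule.span ℝ (ℓ '' S))]
    have : (Submodule.span ℝ (ℓ '' S)).dualCoannihilator = ⊥ := by
      refine (Submodule.eq_bot_iff _).2 fun a ha => ?_
      have h0 : ∀ i ∈ S, ℓ i a = 0 := fun i hi =>
        (Submodule.mem_dualCoannihilator _).1 ha _ (Submodule.subset_span ⟨i, hi, rfl⟩)
      exact hs a (hS a fun i hi => (h0 i hi).ge) (hS _ fun i hi => by simp [h0 i hi])
    simp [this]
  let b := Module.Basis.ofSpan hspan
  have : Fintype _ := Module.Basis.fintypeIndexOfRankLtAleph0 b (Module.rank_lt_aleph0 _ _)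
  have hbS : ∀ j, ∃ i ∈ S, ℓ i = b j := fun j =>
    Module.Basis.ofSpan_subset hspan ⟨j, rfl⟩
  choose f hfS hf using hbS
  let y := b.dualBasis.map (Module.evalEquiv ℝ (Fin d → ℝ)).symm
  have hby : ∀ i j, b i (y j) = if i = j then 1 else 0 := by
    intro i j
    have : Module.evalEquiv ℝ (Fin d → ℝ) (y j) = b.dualBasis j := by simp [y]
    rw [← Module.Dual.eval_apply, ← Module.evalEquiv_apply, this]
    simp [Finsupp.single_apply]
  have hrepr : ∀ a j, y.repr a j = b j a := by
    intro a j
    conv_rhs => rw [← y.sum_repr a]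
    simp only [map_sum, map_smul, hby, smul_eq_mul, mul_ite, mul_one, mul_zero]
    simp
  have hyK : ∀ j, y j ∈ polyhedralSet ℓ := by
    intro j
    have hF := FaceSpans.finset hv h htop ((Finset.univ.erase j).image f) (by
      intro i hi
      obtain ⟨k, -, rfl⟩ := Finset.mem_image.1 hi
      exact hface _ (hfS k))
    have hyj := hF (y j) (by
      intro i hi
      obtain ⟨k, hk, rfl⟩ := Finset.mem_image.1 (Finset.mem_coe.1 hi)
      rw [hf, hby, if_neg (Finset.ne_of_mem_erase hk)])
    -- The line through `y j` is spanned by a face, hence contains a nonzero point `a` of the cone.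
    obtain ⟨a, ⟨haK, ha0⟩, hane⟩ : ∃ a ∈ {a | a ∈ polyhedralSet ℓ ∧
        ∀ i ∈ (((Finset.univ.erase j).image f : Finset (Fin m)) : Set (Fin m)), ℓ i a = 0},
        b j a ≠ 0 := by
      by_contra! hcon
      have hle : Submodule.span ℝ _ ≤ LinearMap.ker (b j) := Submodule.span_le.2 hcon
      exact one_ne_zero (((hby j j).trans (if_pos rfl)).symm.trans (hle hyj))
    have hay : a = b j a • y j := by
      conv_lhs => rw [← y.sum_repr a]
      refine Finset.sum_eq_single j (fun k _ hk => ?_) (by simp) |>.trans (by rw [hrepr])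
      have : b k a = 0 := by
        rw [← hf]
        exact ha0 _ (Finset.mem_coe.2 (Finset.mem_image_of_mem f (by simp [hk])))
      rw [hrepr, this, zero_smul]
    have hpos : 0 < b j a := lt_of_le_of_ne (hf j ▸ haK (f j)) hane.symm
    intro i
    have := haK i
    rw [hay, map_smul, smul_eq_mul] at this
    exact nonneg_of_mul_nonneg_right this hpos
  refine ⟨Set.range y, Set.finite_range _, y.linearIndependent.linearIndepOn_id, le_antisymm ?_ ?_⟩
  · refine Submodule.span_le.2 ?_
    rintro _ ⟨j, rfl⟩
    exact hC.symm ▸ hyK j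
  · intro a ha
    have ha' : a ∈ polyhedralSet ℓ := hC ▸ ha
    rw [← y.sum_repr a]
    refine Submodule.sum_mem _ fun j _ => ?_
    refine PointedCone.smul_mem _ ?_ (PointedCone.subset_hull ⟨j, rfl⟩)
    rw [hrepr, ← hf]
    exact ha' _

end Faces

/-! ### Simplex cones and the comparison of the extensions -/

/-- The generators of a simplicial cone with full span form a basis, in which the points of the cone
have nonnegative coordinates. -/
lemma exists_basis_of_isSimplicial {d : ℕ} {C : PointedCone ℝ (Fin d → ℝ)} (hC : C.IsSimplicial)
    (htop : Submodule.span ℝ (C : Set (Fin d → ℝ)) = ⊤) :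
    ∃ (s : Set (Fin d → ℝ)) (_ : Fintype s) (b : Module.Basis s ℝ (Fin d → ℝ)),
      (∀ j, b j ∈ C) ∧ ∀ a ∈ C, ∀ j, 0 ≤ b.coord j a := by
  obtain ⟨s, hfin, hli, rfl⟩ := hC
  have hspan : ⊤ ≤ Submodule.span ℝ (Set.range ((↑) : s → Fin d → ℝ)) := by
    rw [Subtype.range_coe, ← htop]
    exact Submodule.span_le.2 (PointedCone.hull_le_span (R := ℝ) s)
  let b := Module.Basis.mk (R := ℝ) hli.linearIndependent hspan
  have hb : ∀ j, b j = j := fun j => Module.Basis.mk_apply hli.linearIndependent hspan j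
  have hb' : ∀ x (hx : x ∈ s), b ⟨x, hx⟩ = x := fun x hx => hb ⟨x, hx⟩
  refine ⟨s, hfin.fintype, b, fun j => ?_, fun a ha j => ?_⟩
  · rw [hb]
    exact PointedCone.subset_hull j.2
  · induction ha using Submodule.span_induction with
    | mem x hx =>
      rw [← hb' x hx, Module.Basis.coord_apply, Module.Basis.repr_self]
      have h01 : (0 : s →₀ ℝ) ≤ Finsupp.single (⟨x, hx⟩ : s) (1 : ℝ) :=
        Finsupp.single_nonneg.2 zero_le_one
      exact h01 j
    | zero => simp
    | add x y _ _ hx hy => rw [map_add]; exact add_nonneg hx hy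
    | smul c x _ hx =>
      have : c • x = (c : ℝ) • x := rfl
      rw [this, map_smul]
      exact mul_nonneg c.2 hx

theorem theorem2p1 (d : ℕ) (C : PointedCone ℝ (Fin d → ℝ))
    (hpoly : IsPolyhedralCone C) (hproper : IsProperConvexCone C) :
    IsPolytopalCone C ∧
    ∀ (m : ℕ) (ℓ : Fin m → Module.Dual ℝ (Fin d → ℝ)) (n : ℕ) (v : Fin n → (Fin d → ℝ)),
      (C : Set (Fin d → ℝ)) = polyhedralSet ℓ → (C : Set (Fin d → ℝ)) = conicalHull v →
      (C.IsSimplicial → polytopalExtension v = polyhedralExtension ℓ) ∧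
      (¬ C.IsSimplicial → polytopalExtension v 2 ⊂ polyhedralExtension ℓ 2) := by
  have hs : ∀ a, a ∈ (C : Set (Fin d → ℝ)) → -a ∈ (C : Set (Fin d → ℝ)) → a = 0 :=
    fun a h1 h2 => hproper.inter_neg.subset ⟨h1, h2⟩
  have htop : Submodule.span ℝ (C : Set (Fin d → ℝ)) = ⊤ :=
    Submodule.eq_top_of_nonempty_interior' _
      (hproper.nonempty_interior.mono (interior_mono Submodule.subset_span))
  constructor
  · obtain ⟨m, ℓ, hℓ⟩ := hpoly
    obtain ⟨n, v, h⟩ := exists_polyhedralSet_eq_conicalHull ℓ (hℓ ▸ hs)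
    exact ⟨n, v, hℓ.trans h⟩
  · intro m ℓ n v hℓ hv
    have hsub : ∀ s, polytopalExtension v s ⊆ polyhedralExtension ℓ s := fun s =>
      polytopalExtension_subset (hv.symm.trans hℓ).subset
    refine ⟨fun hC => ?_, fun hC => ⟨hsub 2, fun hcon => hC ?_⟩⟩
    · obtain ⟨s, _, b, hb, hb'⟩ := exists_basis_of_isSimplicial hC htop
      exact funext fun s => (hsub s).antisymm (polyhedralExtension_subset_of_basis b
        (fun j => hv.subset (hb j)) fun a ha => hb' a (hℓ.symm.subset ha))
    · exact isSimplicial_of_polyhedralExtension_subset hℓ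
        (fun j => (hv.symm.trans hℓ).subset (mem_conicalHull v j)) (hℓ ▸ htop) (hℓ ▸ hs) hcon
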